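/- For positive integers $a_1,\dots,a_N$ ($N\ge 2$) with $\gcd(a_1,\dots,a_N)=1$, let $f_N(a_1,\dots,a_N)$ denote the largest natural number that cannot be written as $x_1a_1+\cdots+x_Na_N$ with all $x_i$ positive integers. Let $N\ge 2$. For every $\varepsilon>0$ and every point $\alpha=(\alpha_1,\dots,\alpha_{N-1})\in\mathbb R^{N-1}$ with $0\le\alpha_1\le\alpha_2\le\cdots\le\alpha_{N-1}\le 1$ there exist integers $0<a_1<a_2<\cdots<a_N$ with $\gcd(a_1,\dots,a_N)=1$ such that $$\left|\alpha_i-\frac{a_i}{a_N}\right|<\varepsilon,\qquad i=1,\dots,N-1,$$ and $$\frac{f_N(a_1,\dots,a_N)}{(a_1\cdots a_N)^{1/(N-1)}}<N-1+\varepsilon.$$ -/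

import Mathlib

/-- `m` is a positive integer combination of the numbers `a i`: all coefficients are at least `1`. -/
def IsPositiveCombination {N : ℕ} (a : Fin N → ℕ) (m : ℕ) : Prop :=
  ∃ x : Fin N → ℕ, (∀ i, 0 < x i) ∧ m = ∑ i, x i * a i

/-- `f = f_N(a)`: the number `f` is the largest natural number that is not a positive integer
combination of the `a i`. The predicate determines `f` uniquely and includes its existence. -/
def IsPositiveFrobenius {N : ℕ} (a : Fin N → ℕ) (f : ℕ) : Prop :=
  IsGreatest {m : ℕ | ¬ IsPositiveCombination a m} f

/-! Write `n = N - 1`. Choose `a` with `m l * a l = c * a n + a (l + 1)` and `a n = ∏ m l`. Modulo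
`a n` the `a l` behave like place values with radices `m l`, so when `a 0` is a unit, digits below
`m l` reach every residue and the Frobenius number is at most `∑ m l * a l`. The product of all the
`a i` is `∏ m l * a l`. All these terms lie between `c * a n` and `(c + 1) * a n`, so the ratio is
at most `n * (1 + 1 / c)`. With `m l = t * p l`, `c = q * t` and `t` large, `a l / a n` is close to
`q / p l`, which approximates `α l`. -/

/-- The solution of the recursion `m i * a i = c * a n + a (i + 1)` with `a n = ∏ l < n, m l`. -/
def carrySeq (m : ℕ → ℕ) (c n i : ℕ) : ℕ :=
  (∏ l ∈ Finset.range i, m l) *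
    (1 + c * ∑ j ∈ Finset.Ico (i + 1) (n + 1), ∏ l ∈ Finset.Ico j n, m l)

theorem carrySeq_last (m : ℕ → ℕ) (c n : ℕ) :
    carrySeq m c n n = ∏ l ∈ Finset.range n, m l := by
  simp [carrySeq]

theorem carrySeq_step (m : ℕ → ℕ) (c : ℕ) {n i : ℕ} (hi : i < n) :
    m i * carrySeq m c n i = c * carrySeq m c n n + carrySeq m c n (i + 1) := by
  rw [carrySeq_last, ← Finset.prod_range_mul_prod_Ico m (show i + 1 ≤ n by omega)]
  unfold carrySeq
  rw [Finset.sum_eq_sum_Ico_succ_bot (show i + 1 < n + 1 by omega), Finset.prod_range_succ]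
  ring

/-- The first term is 1 plus a multiple of `c`, the last is the product of the `m l`. -/
theorem carrySeq_coprime {m : ℕ → ℕ} {c n : ℕ} (h : ∀ l < n, ∀ r, r.Prime → r ∣ m l → r ∣ c) :
    Nat.Coprime (carrySeq m c n 0) (carrySeq m c n n) := by
  rw [carrySeq_last]
  refine Nat.Coprime.prod_right fun l hl => ?_
  refine Nat.coprime_of_dvd fun r hr h0 hm => ?_
  have hc := h l (Finset.mem_range.1 hl) r hr hm
  have h1 : r ∣ 1 := by
    have h0' : r ∣ 1 + c * ∑ j ∈ Finset.Ico (0 + 1) (n + 1), ∏ l ∈ Finset.Ico j n, m l := by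
      simpa [carrySeq] using h0
    exact (Nat.dvd_add_left (hc.mul_right _)).1 h0'
  exact hr.one_lt.ne' (Nat.dvd_one.1 h1)

/-- Mixed radix expansion: each multiple of `a 0` has digits `x l < m l` modulo `a n`. -/
theorem exists_digits {a m : ℕ → ℕ} {n : ℕ} (hm : ∀ l < n, 0 < m l)
    (hstep : ∀ l < n, m l * a l ≡ a (l + 1) [MOD a n]) (y : ℕ) {k : ℕ} (hk : k ≤ n) :
    ∃ (x : ℕ → ℕ) (z : ℕ), (∀ l < k, x l < m l) ∧
      y * a 0 ≡ ∑ l ∈ Finset.range k, x l * a l + z * a k [MOD a n] := by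
  induction k with
  | zero => exact ⟨0, y, by simp, by simp [Nat.ModEq.refl]⟩
  | succ k ih =>
    obtain ⟨x, z, hx, hy⟩ := ih (by omega)
    refine ⟨Function.update x k (z % m k), z / m k, fun l hl => ?_, hy.trans ?_⟩
    · rcases eq_or_ne l k with rfl | h
      · simpa using Nat.mod_lt _ (hm l (by omega))
      · simpa [h] using hx l (by omega)
    · have hsum : ∑ l ∈ Finset.range k, Function.update x k (z % m k) l * a l =
          ∑ l ∈ Finset.range k, x l * a l :=
        Finset.sum_congr rfl fun l hl => by
          rw [Function.update_of_ne (Finset.mem_range.1 hl).ne]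
      rw [Finset.sum_range_succ, hsum, Function.update_self, add_assoc]
      refine Nat.ModEq.add_left _ ?_
      calc z * a k = z % m k * a k + z / m k * (m k * a k) := by
            conv_lhs => rw [← Nat.mod_add_div z (m k)]
            ring
        _ ≡ _ [MOD a n] := ((hstep k (by omega)).mul_left _).add_left _

theorem isPositiveCombination_of_lt {a m : ℕ → ℕ} {n : ℕ} (hm : ∀ l < n, 0 < m l)
    (hn : 0 < a n) (hcop : Nat.Coprime (a 0) (a n))
    (hstep : ∀ l < n, m l * a l ≡ a (l + 1) [MOD a n]) {s : ℕ}
    (hs : ∑ l ∈ Finset.range n, m l * a l < s) :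
    IsPositiveCombination (fun i : Fin (n + 1) => a i) s := by
  have hle : ∑ l ∈ Finset.range n, a l ≤ ∑ l ∈ Finset.range n, m l * a l :=
    Finset.sum_le_sum fun l hl => Nat.le_mul_of_pos_left _ (hm l (Finset.mem_range.1 hl))
  obtain ⟨u, hu⟩ : ∃ u, a 0 * u ≡ 1 [MOD a n] := by
    obtain ⟨u, -, hu⟩ := Nat.exists_mul_mod_eq_of_coprime 1 hcop hn.ne'
    exact ⟨u, hu⟩
  obtain ⟨x, z, hx, hy⟩ := exists_digits hm hstep
    (u * (s - ∑ l ∈ Finset.range n, a l)) le_rfl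
  have hmod : ∑ l ∈ Finset.range n, (x l + 1) * a l ≡ s [MOD a n] := by
    have h1 : u * (s - ∑ l ∈ Finset.range n, a l) * a 0 ≡
        s - ∑ l ∈ Finset.range n, a l [MOD a n] := by
      have : a 0 * u * (s - ∑ l ∈ Finset.range n, a l) ≡
        1 * (s - ∑ l ∈ Finset.range n, a l) [MOD a n] := Nat.ModEq.mul_right _ hu
      convert this using 1 <;> ring
    have h2 : z * a n ≡ 0 [MOD a n] := by simp [Nat.ModEq]
    have h3 := (h1.symm.trans (hy.trans (h2.add_left _))).add_right (∑ l ∈ Finset.range n, a l)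
    rw [Nat.sub_add_cancel (by omega), add_zero, ← Finset.sum_add_distrib] at h3
    simpa only [add_mul, one_mul] using h3.symm
  -- Raising each digit by one makes it positive and still at most `m l`; strictness leaves a
  -- positive coefficient for `a n`.
  have hlt : ∑ l ∈ Finset.range n, (x l + 1) * a l < s :=
    (Finset.sum_le_sum fun l hl =>
      Nat.mul_le_mul_right _ (hx l (Finset.mem_range.1 hl))).trans_lt hs
  obtain ⟨w, hw⟩ := (Nat.modEq_iff_dvd' hlt.le).1 hmod
  have hw0 : 0 < w := by
    rcases Nat.eq_zero_or_pos w with rfl | h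
    · omega
    · exact h
  refine ⟨fun i => if (i : ℕ) < n then x i + 1 else w, fun i => ?_, ?_⟩
  · dsimp only
    split_ifs <;> omega
  · rw [Fin.sum_univ_castSucc]
    simp only [Fin.val_castSucc, Fin.is_lt, if_true, Fin.val_last, lt_irrefl, if_false]
    rw [Fin.sum_univ_eq_sum_range (fun l => (x l + 1) * a l) n, mul_comm w, ← hw]
    omega

theorem exists_isPositiveFrobenius_le {N : ℕ} {a : Fin (N + 1) → ℕ} {B : ℕ} (ha : ∀ i, 0 < a i)
    (h : ∀ s, B < s → IsPositiveCombination a s) : ∃ f, IsPositiveFrobenius a f ∧ f ≤ B := by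
  have hne : {s : ℕ | ¬ IsPositiveCombination a s}.Nonempty := by
    refine ⟨0, ?_⟩
    rintro ⟨x, hx, h0⟩
    have h1 := Finset.sum_eq_zero_iff.1 h0.symm 0 (Finset.mem_univ _)
    exact (Nat.mul_pos (hx 0) (ha 0)).ne' h1
  have hB : B ∈ upperBounds {s : ℕ | ¬ IsPositiveCombination a s} := fun s hs => by
    by_contra hlt
    exact hs (h s (by omega))
  have hmem := Nat.sSup_mem hne ⟨B, hB⟩
  exact ⟨_, ⟨hmem, fun s hs => le_csSup ⟨B, hB⟩ hs⟩, hB hmem⟩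

/-- A weakly increasing point of the unit cube is approximated by quotients `q / p i` whose
denominators are strictly decreasing and end in `q`. -/
theorem exists_denominators (n : ℕ) {ε : ℝ} (hε : 0 < ε) (α : Fin n → ℝ)
    (hα1 : ∀ i, α i ≤ 1) (hαmono : Monotone α) (hα0 : ∀ i, 0 ≤ α i) :
    ∃ (q : ℕ) (p : ℕ → ℕ), 0 < q ∧ p n = q ∧ (∀ i < n, p (i + 1) < p i) ∧
      ∀ i : Fin n, |α i - (q : ℝ) / p i| < ε := by
  obtain ⟨δ, hδ0, hδ1, hδε⟩ : ∃ δ : ℝ, 0 < δ ∧ δ ≤ 1 ∧ δ ≤ ε / 2 :=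
    ⟨min 1 (ε / 2), by positivity, min_le_left _ _, min_le_right _ _⟩
  obtain ⟨q, hq⟩ := exists_nat_gt ((n + 1) / (ε / 2))
  have hq0 : (0 : ℝ) < q := lt_of_le_of_lt (by positivity) hq
  -- The floor `δ` keeps `q / β i` finite when `α i = 0`.
  let β : ℕ → ℝ := fun i => if h : i < n then max (α ⟨i, h⟩) δ else 1
  have hβ0 : ∀ i, 0 < β i := fun i => by
    dsimp only [β]; split_ifs
    · exact lt_max_of_lt_right hδ0
    · exact one_pos
  have hβ1 : ∀ i, β i ≤ 1 := fun i => by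
    dsimp only [β]; split_ifs
    · exact max_le (hα1 _) hδ1
    · exact le_rfl
  have hβmono : ∀ i, β i ≤ β (i + 1) := fun i => by
    by_cases h : i + 1 < n
    · have h' : i < n := by omega
      simp only [β, h, h', dif_pos]
      exact max_le_max_right _ (hαmono (by simp [Fin.le_def]))
    · simpa [β, h] using hβ1 i
  -- The ceilings decrease only weakly; `n - i` makes them strict, at a cost negligible against `q`.
  refine ⟨q, fun i => ⌈q / β i⌉₊ + (n - i), by exact_mod_cast hq0, by simp [β],
    fun i hi => ?_, fun i => ?_⟩
  · have : ⌈q / β (i + 1)⌉₊ ≤ ⌈q / β i⌉₊ :=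
      Nat.ceil_le_ceil (div_le_div_of_nonneg_left hq0.le (hβ0 i) (hβmono i))
    dsimp only
    omega
  · set P : ℝ := ((⌈q / β i⌉₊ + (n - i) : ℕ) : ℝ) with hP
    have hdiv : 0 < q / β i := div_pos hq0 (hβ0 i)
    have hlow : q / β i ≤ P := by
      rw [hP]; push_cast
      have := Nat.le_ceil (q / β i)
      have h2 : (0 : ℝ) ≤ ((n - i : ℕ) : ℝ) := Nat.cast_nonneg _
      linarith
    have hupp : P ≤ q / β i + (n + 1) := by
      rw [hP]; push_cast
      have := Nat.ceil_lt_add_one hdiv.le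
      have h2 : ((n - i : ℕ) : ℝ) ≤ n := by exact_mod_cast Nat.sub_le _ _
      linarith
    have hP0 : 0 < P := hdiv.trans_le hlow
    have hβq : β i * (q / β i) = q := mul_div_cancel₀ _ (hβ0 i).ne'
    have h1 : (q : ℝ) / P ≤ β i := by
      rw [div_le_iff₀ hP0]
      nlinarith [mul_le_mul_of_nonneg_left hlow (hβ0 i).le]
    have h2 : β i - ε / 2 < q / P := by
      have hqP : (q : ℝ) ≤ P := by
        nlinarith [hβ1 i, hβq]
      rw [div_lt_iff₀ (by positivity)] at hq
      rw [lt_div_iff₀ hP0]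
      have h3 := mul_le_mul_of_nonneg_left hupp (hβ0 i).le
      have h4 : ε / 2 * q ≤ ε / 2 * P := mul_le_mul_of_nonneg_left hqP (by positivity)
      have h5 : β i * (n + 1 : ℝ) ≤ 1 * (n + 1) :=
        mul_le_mul_of_nonneg_right (hβ1 i) (by positivity)
      nlinarith
    have hβi : β i = max (α i) δ := by simp [β]
    have h6 : α i ≤ β i := hβi ▸ le_max_left _ _
    have h7 : β i ≤ α i + ε / 2 := by
      rw [hβi]
      exact max_le (by linarith) (by linarith [hα0 i])
    rw [abs_lt]
    constructor <;> linarith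

theorem corollary3 (n : ℕ) (hn : 1 ≤ n) (ε : ℝ) (hε : 0 < ε) (α : Fin n → ℝ)
    (hα0 : ∀ i, 0 ≤ α i) (hα1 : ∀ i, α i ≤ 1) (hαmono : Monotone α) :
    ∃ a : Fin (n + 1) → ℕ,
      (∀ i, 0 < a i) ∧ StrictMono a ∧ Finset.univ.gcd a = 1 ∧
      (∀ i : Fin n, |α i - (a i.castSucc : ℝ) / (a (Fin.last n) : ℝ)| < ε) ∧
      ∃ f : ℕ, IsPositiveFrobenius a f ∧
        (f : ℝ) / (∏ i, (a i : ℝ)) ^ (1 / (n : ℝ)) < (n : ℝ) + ε := by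
  obtain ⟨q, p, hq, hpn, hp, happrox⟩ :=
    exists_denominators n (half_pos hε) α hα1 hαmono hα0
  have hqp : ∀ i ≤ n, q ≤ p i := fun i hi => by
    induction hi using Nat.decreasingInduction with
    | self => exact hpn.ge
    | of_succ k hk ih => exact ih.trans (hp k hk).le
  have hp0 : ∀ i ≤ n, 0 < p i := fun i hi => hq.trans_le (hqp i hi)
  -- Divisibility by each `p l` puts every prime factor of `t * p l` into `c = q * t`; `2 ≤ t`
  -- serves monotonicity.
  obtain ⟨t, ht2, htε, htn, htp⟩ : ∃ t : ℕ, 2 ≤ t ∧ 1 / (ε / 2) < (t : ℝ) ∧ n / ε < (t : ℝ) ∧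
      ∀ l < n, p l ∣ t := by
    obtain ⟨K, hK⟩ := exists_nat_gt (max (1 / (ε / 2)) (n / ε))
    have hprod : 0 < ∏ l ∈ Finset.range n, p l :=
      Finset.prod_pos fun l hl => hp0 l (Finset.mem_range.1 hl).le
    have hle : K + 2 ≤ (K + 2) * ∏ l ∈ Finset.range n, p l := Nat.le_mul_of_pos_right _ hprod
    have hKt : (K : ℝ) < (((K + 2) * ∏ l ∈ Finset.range n, p l : ℕ) : ℝ) := by
      exact_mod_cast (by omega : K < (K + 2) * ∏ l ∈ Finset.range n, p l)
    exact ⟨(K + 2) * ∏ l ∈ Finset.range n, p l, by omega,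
      ((le_max_left _ _).trans_lt hK).trans hKt, ((le_max_right _ _).trans_lt hK).trans hKt,
      fun l hl => (Finset.dvd_prod_of_mem p (Finset.mem_range.2 hl)).mul_left _⟩
  let m : ℕ → ℕ := fun l => t * p l
  let a : ℕ → ℕ := carrySeq m (q * t) n
  have hm : ∀ l < n, 0 < m l := fun l hl => Nat.mul_pos (by omega) (hp0 l hl.le)
  have hM : 0 < a n := by
    simp only [a, carrySeq_last]
    exact Finset.prod_pos fun l hl => hm l (Finset.mem_range.1 hl)
  have hstep : ∀ l < n, t * p l * a l = q * t * a n + a (l + 1) :=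
    fun l hl => carrySeq_step m (q * t) hl
  have hlow : ∀ i ≤ n, q * a n ≤ p i * a i := fun i hi => by
    rcases hi.eq_or_lt with rfl | hi
    · rw [hpn]
    · have := hstep i hi
      nlinarith
  have hpos : ∀ i ≤ n, 0 < a i := fun i hi =>
    Nat.pos_of_mul_pos_left ((Nat.mul_pos hq hM).trans_le (hlow i hi))
  have hlt : ∀ i < n, a i < a (i + 1) := fun i hi => by
    have h1 := hstep i hi
    have h2 := hlow (i + 1) hi
    have h3 := hp i hi
    have h4 : t * (p (i + 1) + 1) * a (i + 1) ≤ t * p i * a (i + 1) := by gcongr; omega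
    have h5 := hpos (i + 1) hi
    have h6 : t * (q * a n) ≤ t * (p (i + 1) * a (i + 1)) := Nat.mul_le_mul_left _ h2
    have h7 : 2 * a (i + 1) ≤ t * a (i + 1) := Nat.mul_le_mul_right _ ht2
    -- The slack `p (i + 1) + 1 ≤ p i`, scaled by `t`, outweighs the carry `a (i + 1)`.
    have h8 : t * p i * a i < t * p i * a (i + 1) := by nlinarith
    exact lt_of_mul_lt_mul_left h8 (Nat.zero_le _)
  have hmono : StrictMono fun i : Fin (n + 1) => a i :=
    Fin.strictMono_iff_lt_succ.2 fun i => by simpa using hlt i i.2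
  have hleM : ∀ i ≤ n, a i ≤ a n := fun i hi =>
    hmono.monotone (show (⟨i, by omega⟩ : Fin (n + 1)) ≤ Fin.last n from Fin.le_last _)
  have hcop : Nat.Coprime (a 0) (a n) := carrySeq_coprime fun l hl r hr hrm => by
    refine Dvd.dvd.mul_left ?_ q
    rcases hr.dvd_mul.1 hrm with h | h
    · exact h
    · exact h.trans (htp l hl)
  have hmod : ∀ l < n, m l * a l ≡ a (l + 1) [MOD a n] := fun l hl => by
    rw [show m l * a l = _ from hstep l hl]
    simp [Nat.ModEq]
  have hMR : (0 : ℝ) < a n := by exact_mod_cast hM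
  have htR : (0 : ℝ) < t := by positivity
  have hqR : (1 : ℝ) ≤ q := by exact_mod_cast hq
  refine ⟨fun i => a i, fun i => hpos i (by omega), hmono, ?_, fun i => ?_, ?_⟩
  · refine Nat.eq_one_of_dvd_coprimes hcop ?_ ?_
    · exact Finset.gcd_dvd (f := fun i : Fin (n + 1) => a i) (Finset.mem_univ 0)
    · exact Finset.gcd_dvd (f := fun i : Fin (n + 1) => a i) (Finset.mem_univ (Fin.last n))
  · simp only [Fin.val_castSucc, Fin.val_last]
    have hpi : (1 : ℝ) ≤ p i := by exact_mod_cast hp0 i i.2.le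
    have hrec : (t : ℝ) * p i * a i = q * t * a n + a (i + 1) := by exact_mod_cast hstep i i.2
    have hi1 : (a (i + 1) : ℝ) ≤ a n := by exact_mod_cast hleM (i + 1) i.2
    have heq : (a i : ℝ) / a n = q / p i + a (i + 1) / a n / (t * p i) := by
      field_simp
      linarith
    have h1 : (a (i + 1) : ℝ) / a n ≤ 1 := (div_le_one hMR).2 hi1
    have h0 : (0 : ℝ) ≤ a (i + 1) / a n := by positivity
    have h2 : (a (i + 1) : ℝ) / a n / (t * p i) < ε / 2 := by
      rw [div_lt_iff₀ (by positivity)]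
      rw [div_lt_iff₀ (by positivity)] at htε
      nlinarith [mul_le_mul_of_nonneg_left hpi (by positivity : 0 ≤ ε / 2 * t)]
    have h3 : (0 : ℝ) ≤ a (i + 1) / a n / (t * p i) := by positivity
    have h4 := abs_lt.1 (happrox i)
    rw [heq, abs_lt]
    constructor <;> linarith
  · obtain ⟨f, hf, hfB⟩ := exists_isPositiveFrobenius_le
      (a := fun i : Fin (n + 1) => a i) (fun i => hpos i (by omega))
      fun s hs => isPositiveCombination_of_lt hm hM hcop hmod hs
    refine ⟨f, hf, ?_⟩
    have hfR : (f : ℝ) ≤ n * ((q * t + 1) * a n) := by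
      have : ∑ l ∈ Finset.range n, m l * a l ≤ n * ((q * t + 1) * a n) := by
        refine (Finset.sum_le_card_nsmul _ _ ((q * t + 1) * a n) fun l hl => ?_).trans_eq
          (by simp)
        have hl := Finset.mem_range.1 hl
        rw [show m l * a l = _ from hstep l hl, add_mul, one_mul]
        exact Nat.add_le_add_left (hleM (l + 1) hl) _
      exact_mod_cast hfB.trans this
    have hprodN : (q * t * a n) ^ n ≤ ∏ i : Fin (n + 1), a i := by
      have h1 : ∏ l ∈ Finset.range n, t * (q * a n) ≤ ∏ l ∈ Finset.range n, m l * a l :=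
        Finset.prod_le_prod' fun l hl => by
          have := Nat.mul_le_mul_left t (hlow l (Finset.mem_range.1 hl).le)
          simpa [m, mul_assoc] using this
      calc (q * t * a n) ^ n = ∏ l ∈ Finset.range n, t * (q * a n) := by
            rw [Finset.prod_const, Finset.card_range]
            congr 1
            ring
        _ ≤ ∏ l ∈ Finset.range n, m l * a l := h1
        _ = a n * ∏ l ∈ Finset.range n, a l := by
            rw [Finset.prod_mul_distrib, ← carrySeq_last m (q * t) n]
        _ = ∏ i : Fin (n + 1), a i := by
            rw [Fin.prod_univ_eq_prod_range a (n + 1), Finset.prod_range_succ, mul_comm]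
    have hroot : (q * t * a n : ℝ) ≤ (∏ i : Fin (n + 1), (a i : ℝ)) ^ (1 / (n : ℝ)) := by
      have h1 : ((q * t * a n : ℝ)) ^ n ≤ ∏ i : Fin (n + 1), (a i : ℝ) := by
        exact_mod_cast hprodN
      calc (q * t * a n : ℝ) = ((q * t * a n : ℝ) ^ n) ^ (1 / (n : ℝ)) := by
            rw [one_div, Real.pow_rpow_inv_natCast (by positivity) (by omega)]
        _ ≤ _ := Real.rpow_le_rpow (by positivity) h1 (by positivity)
    have hbase : (0 : ℝ) < q * t * a n := by positivity
    rw [div_lt_iff₀ (hbase.trans_le hroot)]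
    rw [div_lt_iff₀ hε] at htn
    have hnε : (n : ℝ) * a n < ε * (q * t * a n) := by
      have : (n : ℝ) < ε * (q * t) := by
        nlinarith [mul_le_mul_of_nonneg_left hqR (by positivity : 0 ≤ ε * t)]
      nlinarith [mul_lt_mul_of_pos_right this hMR]
    calc (f : ℝ) ≤ n * ((q * t + 1) * a n) := hfR
      _ < (n + ε) * (q * t * a n) := by linarith
      _ ≤ _ := mul_le_mul_of_nonneg_left hroot (by positivity)
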